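/- Let $Q$ be a smooth (finite-dimensional, Hausdorff, second countable) manifold and $G$ a Lie group with Lie algebra $\mathfrak g$ acting smoothly, freely and properly on the left on $Q$, so that $\pi:Q\to Q/G$ is a smooth principal $G$-bundle. Let $L_d:Q\times Q\to\mathbb R$ be smooth and invariant under the diagonal action of $G$. Fix $N\ge 0$ and put $S_d(q_\cdot)=\sum_{k=0}^{N-1}L_d(q_k,q_{k+1})$ for $q_\cdot=(q_0,\dots,q_N)\in Q^{N+1}$. Let $\tilde G=(Q\times G)/G$ be the quotient by the action $g\cdot(q,w)=(gq,gwg^{-1})$, with its quotient manifold structure and projection $\rho:Q\times G\to\tilde G$. Let $\mathrm{Hor}\subseteq Q\times Q$ be an affine discrete connection on $\pi$ with level $\gamma$: $\gamma:Q\to G$ is smooth with $\gamma(gq)=g\gamma(q)g^{-1}$, and $\mathrm{Hor}$ is an embedded submanifold, invariant under the diagonal action, that contains $\{(q,\gamma(q)q)\mid q\in Q\}$ and on which $\mathrm{id}_Q\times\pi$ restricts to an injective local diffeomorphism $\mathrm{Hor}\to Q\times(Q/G)$. Assume that it is globally defined, that is, every pair in $Q\times Q$ is of the form $(q_0,gq_1)$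 with $(q_0,q_1)\in\mathrm{Hor}$ and $g\in G$. Let $\mathcal A_d:Q\times Q\to G$ be its connection form ($\mathcal A_d(q_0,q_1)$ is the unique $g$ with $(q_0,g^{-1}q_1)\in\mathrm{Hor}$), and let $\overline{h_d^{q_0}}(\tau)$ be the unique $q_1$ with $(q_0,q_1)\in\mathrm{Hor}$ and $\pi(q_1)=\tau$. The reduced Lagrangian $\hat L_d:\tilde G\times(Q/G)\to\mathbb R$ is $\hat L_d(\rho(q_0,w_0),\tau_1)=L_d\big(q_0,w_0\,\overline{h_d^{q_0}}(\tau_1)\big)$, and $\hat S_d(v_\cdot,\tau_\cdot)=\sum_{k=0}^{N-1}\hat L_d(v_k,\tau_{k+1})$ for $((v_0,\tau_1),\dots,(v_{N-1},\tau_N))\in(\tilde G\times Q/G)^N$. Let $\mathfrak A$ be a principal connection on $\pi$ with horizontal lift $h^q:T_{\pi(q)}(Q/G)\to T_qQ$, and for $\xi\in\mathfrak g$ let $\xi_Q$ be the infinitesimal generator of the action. Let $q_\cdot=(q_0,\dots,q_N)$ be a discrete curve in $Q$, and put $\tau_k=\pi(q_k)$, $w_k=\mathcal A_d(q_k,q_{k+1})$,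 $v_k=\rho(q_k,w_k)$. (A) For every infinitesimal variation $\delta q_\cdot$ of $q_\cdot$ (that is, $\delta q_k\in T_{q_k}Q$ for $k=0,\dots,N$), $$dS_d(q_\cdot)(\delta q_\cdot)=d\hat S_d(v_\cdot,\tau_\cdot)(\delta v_\cdot,\delta\tau_\cdot),$$ where $\delta\tau_k=T_{q_k}\pi(\delta q_k)$ and $\delta v_k=T_{(q_k,w_k)}\rho\big(\delta q_k,T_{(q_k,q_{k+1})}\mathcal A_d(\delta q_k,\delta q_{k+1})\big)$. (B) The following are equivalent. 1. $dS_d(q_\cdot)(\delta q_\cdot)=0$ for all infinitesimal variations $\delta q_\cdot$ of $q_\cdot$ with $\delta q_0=0$ and $\delta q_N=0$. 2. $d\hat S_d(v_\cdot,\tau_\cdot)(\delta v_\cdot,\delta\tau_\cdot)=0$ for all $\delta\tau_k\in T_{\tau_k}(Q/G)$ ($k=0,\dots,N$) and all $\xi_0,\dots,\xi_N\in\mathfrak g$ with $\delta\tau_0=0$, $\delta\tau_N=0$, $\xi_0=\xi_N=0$, where for $k=0,\dots,N-1$ $$\begin{aligned}\delta v_k={}&T_{(q_k,w_k)}\rho\big(h^{q_k}(\delta\tau_k),\,T_{(q_k,q_{k+1})}\mathcal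 A_d(h^{q_k}(\delta\tau_k),h^{q_{k+1}}(\delta\tau_{k+1}))\big)\\&+T_{(q_k,w_k)}\rho\big((\xi_k)_Q(q_k),\,T_{(q_k,q_{k+1})}\mathcal A_d((\xi_k)_Q(q_k),(\xi_{k+1})_Q(q_{k+1}))\big).\end{aligned}$$ -/

import Mathlib

open scoped Manifold ContDiff Topology

noncomputable section

namespace DiscreteReduction

/-! ### Discrete mechanical systems

A tangent vector of a product manifold is the tuple of its components; the functions
`pairVec` and `tupleVec` below are this identification. -/

section Mechanics

variable {E : Type*} [NormedAddCommGroup E] [NormedSpace ℝ E]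
  {F : Type*} [NormedAddCommGroup F] [NormedSpace ℝ F]
  {M : Type*} [TopologicalSpace M] [ChartedSpace E M]
  {P : Type*} [TopologicalSpace P] [ChartedSpace F P]

/-- The tangent vector `(u, v)` of `M × P` at `(x, y)`. -/
def pairVec {x : M} {y : P} (u : TangentSpace 𝓘(ℝ, E) x) (v : TangentSpace 𝓘(ℝ, F) y) :
    TangentSpace (𝓘(ℝ, E).prod 𝓘(ℝ, F)) ((x, y) : M × P) :=
  ((u, v) : E × F)

/-- The discrete action `S_d(q) = ∑_{k < N} L_d(q_k, q_{k+1})` on discrete curves in `M`. -/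
def discreteAction (N : ℕ) (L : M × M → ℝ) (q : Fin (N + 1) → M) : ℝ :=
  ∑ k : Fin N, L (q k.castSucc, q k.succ)

/-- The differential `dS_d(q)(δq)` of the discrete action, a function on the product manifold
`M^{N+1}`, along an infinitesimal variation `δq` of `q`. -/
def dDiscreteAction (N : ℕ) (L : M × M → ℝ) (q : Fin (N + 1) → M)
    (δq : ∀ k, TangentSpace 𝓘(ℝ, E) (q k)) : ℝ :=
  mfderiv (ModelWithCorners.pi fun _ : Fin (N + 1) => 𝓘(ℝ, E)) 𝓘(ℝ, ℝ)
    (discreteAction N L) q (show ∀ _ : Fin (N + 1), E from δq)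

/-- The reduced discrete action `∑_{k < N} L̂(v_k, τ_{k+1})` on curves in `M × P`; the `k`-th entry
of the curve is the pair `(v_k, τ_{k+1})`. -/
def reducedAction (N : ℕ) (L : M × P → ℝ) (c : Fin N → M × P) : ℝ :=
  ∑ k : Fin N, L (c k)

/-- The differential of the reduced discrete action, a function on the product manifold
`(M × P)^N`. -/
def dReducedAction (N : ℕ) (L : M × P → ℝ) (c : Fin N → M × P)
    (δc : ∀ k, TangentSpace (𝓘(ℝ, E).prod 𝓘(ℝ, F)) (c k)) : ℝ :=
  mfderiv (ModelWithCorners.pi fun _ : Fin N => 𝓘(ℝ, E).prod 𝓘(ℝ, F)) 𝓘(ℝ, ℝ)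
    (reducedAction N L) c (show ∀ _ : Fin N, E × F from δc)

end Mechanics

/-! ### The orbit space, the conjugate bundle, infinitesimal generators -/

section Spaces

variable (G Q : Type*) [Group G] [MulAction G Q]

/-- The orbit space `Q/G`. -/
abbrev OrbitSpace : Type _ := Quotient (MulAction.orbitRel G Q)

variable {Q} in
/-- The projection `π : Q → Q/G`. -/
def orbitProj (q : Q) : OrbitSpace G Q := Quotient.mk (MulAction.orbitRel G Q) q

/-- The orbit relation on `Q × G` of the action `g · (q, w) = (g q, g w g⁻¹)`. -/
def conjSetoid : Setoid (Q × G) where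
  r a b := ∃ g : G, (g • b.1, g * b.2 * g⁻¹) = a
  iseqv :=
    { refl := fun a => ⟨1, by simp⟩
      symm := by
        rintro _ b ⟨g, rfl⟩
        exact ⟨g⁻¹, by simp [mul_assoc]⟩
      trans := by
        rintro _ _ c ⟨g, rfl⟩ ⟨h, rfl⟩
        exact ⟨g * h, by simp [mul_assoc, mul_smul]⟩ }

/-- The associated conjugate bundle `G̃ = (Q × G)/G`, with the quotient topology. -/
abbrev ConjBundle : Type _ := Quotient (conjSetoid G Q)

variable {G Q} in
/-- The projection `ρ : Q × G → G̃`. -/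
def conjProj (p : Q × G) : ConjBundle G Q := Quotient.mk (conjSetoid G Q) p

end Spaces

section Principal

variable {E : Type*} [NormedAddCommGroup E] [NormedSpace ℝ E]
  {EG : Type*} [NormedAddCommGroup EG] [NormedSpace ℝ EG]
  {EB : Type*} [NormedAddCommGroup EB] [NormedSpace ℝ EB]
  {G : Type*} [TopologicalSpace G] [ChartedSpace EG G] [Group G]
  {Q : Type*} [TopologicalSpace Q] [ChartedSpace E Q] [MulAction G Q]

/-- The infinitesimal generator `ξ_Q(q) ∈ T_q Q` of `ξ ∈ 𝔤 = T_1 G`: the velocity at the identity,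
in the direction `ξ`, of the orbit map `g ↦ g q`. -/
def infGen (ξ : GroupLieAlgebra 𝓘(ℝ, EG) G) (q : Q) : TangentSpace 𝓘(ℝ, E) q :=
  (mfderiv 𝓘(ℝ, EG) 𝓘(ℝ, E) (fun g : G => g • q) 1 ξ : E)

variable (E EG G) in
/-- The vertical space at `q`: the tangent space of the orbit of `q`, i.e. the image of the
differential at the identity of the orbit map `g ↦ g q`. -/
def verticalSpace (q : Q) : Submodule ℝ (TangentSpace 𝓘(ℝ, E) q) :=
  LinearMap.range
    (show EG →ₗ[ℝ] E from (mfderiv 𝓘(ℝ, EG) 𝓘(ℝ, E) (fun g : G => g • q) 1).toLinearMap)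

variable (E EG EB G Q) in
/-- For the given smooth structure on `Q/G`, the projection `π : Q → Q/G` is a smooth principal
bundle with structure group `G`: it is smooth, and every point of `Q/G` has an open neighbourhood
`U` with a `G`-equivariant diffeomorphism `π⁻¹(U) ≅ U × G` over `U`. The topology of `Q/G` is the
quotient topology, and at most one smooth structure has this property: the standard one. -/
def IsSmoothPrincipalBundle [ChartedSpace EB (OrbitSpace G Q)] : Prop :=
  ContMDiff 𝓘(ℝ, E) 𝓘(ℝ, EB) ∞ (orbitProj G : Q → OrbitSpace G Q) ∧
  ∀ b : OrbitSpace G Q, ∃ e : Bundle.Trivialization G (orbitProj G : Q → OrbitSpace G Q),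
    b ∈ e.baseSet ∧
    ContMDiffOn 𝓘(ℝ, E) (𝓘(ℝ, EB).prod 𝓘(ℝ, EG)) ∞ e e.source ∧
    ContMDiffOn (𝓘(ℝ, EB).prod 𝓘(ℝ, EG)) 𝓘(ℝ, E) ∞ e.toOpenPartialHomeomorph.symm e.target ∧
    ∀ (g : G), ∀ q ∈ e.source, (e (g • q)).2 = g * (e q).2

variable (E EG G Q) in
/-- A principal connection: a smooth `G`-invariant distribution of horizontal spaces that are
complementary to the vertical spaces. -/
structure PrincipalConnection [IsManifold 𝓘(ℝ, E) ∞ Q] where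
  /-- The horizontal space at `q`. -/
  hor : ∀ q : Q, Submodule ℝ (TangentSpace 𝓘(ℝ, E) q)
  isCompl : ∀ q, IsCompl (verticalSpace E EG G q) (hor q)
  invariant : ∀ (g : G) (q : Q),
    (hor q).map (mfderiv 𝓘(ℝ, E) 𝓘(ℝ, E) (fun x : Q => g • x) q).toLinearMap = hor (g • q)
  /-- Near every point the horizontal spaces are spanned by a smooth local frame. -/
  smooth : ∀ q₀ : Q, ∃ (d : ℕ) (X : Fin d → ∀ q : Q, TangentSpace 𝓘(ℝ, E) q) (U : Set Q),
    IsOpen U ∧ q₀ ∈ U ∧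
    (∀ i, ContMDiffOn 𝓘(ℝ, E) 𝓘(ℝ, E).tangent ∞
      (fun q => (⟨q, X i q⟩ : TangentBundle 𝓘(ℝ, E) Q)) U) ∧
    ∀ q ∈ U, LinearIndependent ℝ (fun i => X i q) ∧
      Submodule.span ℝ (Set.range fun i => X i q) = hor q

/-- The horizontal lift `h^q(w)` of `w ∈ T_{π(q)}(Q/G)`: the horizontal vector at `q` that `T_q π`
maps to `w`. -/
def PrincipalConnection.lift [IsManifold 𝓘(ℝ, E) ∞ Q] [ChartedSpace EB (OrbitSpace G Q)]
    (A : PrincipalConnection E EG G Q) (q : Q)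
    (w : TangentSpace 𝓘(ℝ, EB) (orbitProj G q)) : TangentSpace 𝓘(ℝ, E) q :=
  Classical.epsilon fun v =>
    v ∈ A.hor q ∧ mfderiv 𝓘(ℝ, E) 𝓘(ℝ, EB) (orbitProj G : Q → OrbitSpace G Q) q v = w

/-! ### Affine discrete connections -/

variable (E EG EB G Q) in
/-- An affine discrete connection on `π : Q → Q/G`: a `G`-invariant embedded submanifold `hor` of
`Q × Q` that contains the graph of `q ↦ γ(q) q`, where `γ = level` is a smooth map that is
equivariant for conjugation, and on which `id × π` restricts to an injective local diffeomorphism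
into `Q × Q/G`. -/
structure AffineDiscreteConnection [ChartedSpace EB (OrbitSpace G Q)] where
  /-- The level function `γ`. -/
  level : Q → G
  level_smooth : ContMDiff 𝓘(ℝ, E) 𝓘(ℝ, EG) ∞ level
  level_smul : ∀ (g : G) (q : Q), level (g • q) = g * level q * g⁻¹
  /-- The submanifold of `Q × Q`. -/
  hor : Set (Q × Q)
  graph_mem : ∀ q, (q, level q • q) ∈ hor
  invariant : ∀ (g : G) (q₀ q₁ : Q), (q₀, q₁) ∈ hor → (g • q₀, g • q₁) ∈ hor
  injOn : Set.InjOn (fun p : Q × Q => (p.1, orbitProj G p.2)) hor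
  submanifold : ∃ (d : ℕ) (_ : ChartedSpace (EuclideanSpace ℝ (Fin d)) hor),
    IsManifold 𝓘(ℝ, EuclideanSpace ℝ (Fin d)) ∞ hor ∧
    Manifold.IsSmoothEmbedding 𝓘(ℝ, EuclideanSpace ℝ (Fin d)) (𝓘(ℝ, E).prod 𝓘(ℝ, E)) ∞
      (Subtype.val : hor → Q × Q) ∧
    IsLocalDiffeomorph 𝓘(ℝ, EuclideanSpace ℝ (Fin d)) (𝓘(ℝ, E).prod 𝓘(ℝ, EB)) ∞
      (fun p : hor => (p.1.1, orbitProj G p.1.2))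

namespace AffineDiscreteConnection

variable [ChartedSpace EB (OrbitSpace G Q)] (A : AffineDiscreteConnection E EG EB G Q)

/-- The domain of the connection: the pairs `(q₀, g q₁)` with `(q₀, q₁)` horizontal. -/
def domain : Set (Q × Q) := {p | ∃ (g : G) (q₁ : Q), (p.1, q₁) ∈ A.hor ∧ p.2 = g • q₁}

/-- The affine discrete connection form `𝒜_d`: the value at `(q₀, q₁)` in the domain is the `g`
for which `(q₀, g⁻¹ q₁)` is horizontal. -/
def form (p : Q × Q) : G := Classical.epsilon fun g => (p.1, g⁻¹ • p.2) ∈ A.hor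

/-- The second component of the discrete horizontal lift: the `q₁` over `τ` for which `(q₀, q₁)`
is horizontal. -/
def lift (q₀ : Q) (τ : OrbitSpace G Q) : Q :=
  @Classical.epsilon Q ⟨q₀⟩ fun q₁ => (q₀, q₁) ∈ A.hor ∧ orbitProj G q₁ = τ

variable {A}

theorem lift_spec (hA : A.domain = Set.univ) (q₀ : Q) (τ : OrbitSpace G Q) :
    (q₀, A.lift q₀ τ) ∈ A.hor ∧ orbitProj G (A.lift q₀ τ) = τ := by
  refine @Classical.epsilon_spec_aux Q ⟨q₀⟩
    (fun q₁ => (q₀, q₁) ∈ A.hor ∧ orbitProj G q₁ = τ) ?_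
  obtain ⟨x, rfl⟩ := Quotient.exists_rep τ
  obtain ⟨g, q₁, h, hx⟩ : (q₀, x) ∈ A.domain := hA ▸ Set.mem_univ _
  refine ⟨q₁, h, Quotient.sound ⟨g⁻¹, ?_⟩⟩
  simp only at hx
  simp [hx]

theorem lift_smul (hA : A.domain = Set.univ) (g : G) (q₀ : Q) (τ : OrbitSpace G Q) :
    A.lift (g • q₀) τ = g • A.lift q₀ τ := by
  have h₁ := lift_spec hA q₀ τ
  have h₂ := lift_spec hA (g • q₀) τ
  have h₃ := A.invariant g _ _ h₁.1
  have h₄ : orbitProj G (g • A.lift q₀ τ) = τ := by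
    rw [← h₁.2]
    exact Quotient.sound ⟨g, by simp [h₁.2]⟩
  have := A.injOn h₂.1 h₃ (by simp only [h₂.2, h₄])
  exact congrArg Prod.snd this

/-- The reduced discrete Lagrangian `L̂_d(ρ(q₀, w₀), τ₁) = L_d(q₀, w₀ h̄_d^{q₀}(τ₁))` on
`G̃ × Q/G` of a `G`-invariant discrete Lagrangian. -/
def reducedLagrangian (A : AffineDiscreteConnection E EG EB G Q) (hA : A.domain = Set.univ)
    (L : Q × Q → ℝ) (hL : ∀ (g : G) (q₀ q₁ : Q), L (g • q₀, g • q₁) = L (q₀, q₁)) :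
    ConjBundle G Q × OrbitSpace G Q → ℝ := fun x =>
  Quotient.lift (fun p : Q × G => L (p.1, p.2 • A.lift p.1 x.2)) (by
    rintro _ b ⟨g, rfl⟩
    simp only [lift_smul hA]
    rw [← hL g b.1]
    simp [mul_smul]) x.1

end AffineDiscreteConnection

/-! ### Reduced curves and reduced variations -/

section Reduced

variable {EC : Type*} [NormedAddCommGroup EC] [NormedSpace ℝ EC] [ChartedSpace EC (ConjBundle G Q)]
  [ChartedSpace EB (OrbitSpace G Q)] (Ad : AffineDiscreteConnection E EG EB G Q)

/-- The map `Υ(q₀, q₁) = (ρ(q₀, 𝒜_d(q₀, q₁)), π(q₁))`. -/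
def reduce (p : Q × Q) : ConjBundle G Q × OrbitSpace G Q :=
  (conjProj (p.1, Ad.form p), orbitProj G p.2)

/-- The reduced curve of `q`: its `k`-th entry is `(v_k, τ_{k+1})` with `τ_k = π(q_k)`,
`w_k = 𝒜_d(q_k, q_{k+1})` and `v_k = ρ(q_k, w_k)`. -/
def reducedCurve {N : ℕ} (q : Fin (N + 1) → Q) : Fin N → ConjBundle G Q × OrbitSpace G Q :=
  fun k => reduce Ad (q k.castSucc, q k.succ)

variable (EC) in
/-- For `δq₀ ∈ T_{q₀} Q` and `δq₁ ∈ T_{q₁} Q`, with `w₀ = 𝒜_d(q₀, q₁)`, the vector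
`T_{(q₀, w₀)} ρ (δq₀, T_{(q₀, q₁)} 𝒜_d (δq₀, δq₁))` tangent to `G̃` at `ρ(q₀, w₀)`. -/
def pushConj {q₀ q₁ : Q} (δq₀ : TangentSpace 𝓘(ℝ, E) q₀) (δq₁ : TangentSpace 𝓘(ℝ, E) q₁) :
    TangentSpace 𝓘(ℝ, EC) (conjProj (q₀, Ad.form (q₀, q₁)) : ConjBundle G Q) :=
  mfderiv (𝓘(ℝ, E).prod 𝓘(ℝ, EG)) 𝓘(ℝ, EC) (conjProj : Q × G → ConjBundle G Q)
    (q₀, Ad.form (q₀, q₁))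
    (pairVec δq₀
      (mfderiv (𝓘(ℝ, E).prod 𝓘(ℝ, E)) 𝓘(ℝ, EG) Ad.form (q₀, q₁) (pairVec δq₀ δq₁)))

variable (EC) in
/-- The variation `(δv, δτ)` of the reduced curve induced by a variation `δq` of `q`:
`δv_k = T ρ (δq_k, T 𝒜_d (δq_k, δq_{k+1}))` and `δτ_k = T_{q_k} π (δq_k)`. -/
def inducedVariation {N : ℕ} (q : Fin (N + 1) → Q) (δq : ∀ k, TangentSpace 𝓘(ℝ, E) (q k))
    (k : Fin N) : TangentSpace (𝓘(ℝ, EC).prod 𝓘(ℝ, EB)) (reducedCurve Ad q k) :=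
  pairVec (pushConj EC Ad (δq k.castSucc) (δq k.succ))
    (mfderiv 𝓘(ℝ, E) 𝓘(ℝ, EB) (orbitProj G : Q → OrbitSpace G Q) (q k.succ) (δq k.succ))

variable (EC) in
/-- The reduced variation `(δv, δτ)` given by `δτ_k ∈ T_{τ_k}(Q/G)` and `ξ_k ∈ 𝔤`:
`δv_k = T ρ (h(δτ_k), T 𝒜_d (h(δτ_k), h(δτ_{k+1})))
  + T ρ ((ξ_k)_Q, T 𝒜_d ((ξ_k)_Q, (ξ_{k+1})_Q))`. -/
def reducedVariation [IsManifold 𝓘(ℝ, E) ∞ Q] (A : PrincipalConnection E EG G Q)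
    {N : ℕ} (q : Fin (N + 1) → Q)
    (δτ : ∀ k, TangentSpace 𝓘(ℝ, EB) (orbitProj G (q k) : OrbitSpace G Q))
    (ξ : Fin (N + 1) → GroupLieAlgebra 𝓘(ℝ, EG) G)
    (k : Fin N) : TangentSpace (𝓘(ℝ, EC).prod 𝓘(ℝ, EB)) (reducedCurve Ad q k) :=
  pairVec
    (pushConj EC Ad (A.lift (q k.castSucc) (δτ k.castSucc)) (A.lift (q k.succ) (δτ k.succ)) +
      pushConj EC Ad (infGen (E := E) (ξ k.castSucc) (q k.castSucc))
        (infGen (E := E) (ξ k.succ) (q k.succ)))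
    (δτ k.succ)

end Reduced

end Principal

end DiscreteReduction

end

/-! The discrete Lagrangian factors as `L = L̂ ∘ Υ` with `Υ = reduce Ad`: the connection form
carries the horizontal lift of `π(q₁)` back to `q₁` (`form_smul_lift`), which is
`reducedLagrangian_reduce`. Both actions are sums of terms in consecutive points, so the chain rule
applied to each term gives (A).

For (B), every tangent vector of `Q` splits as a horizontal lift plus an infinitesimal generator
(`exists_eq_lift_add_infGen`). Since `Tπ` kills generators and `T Υ` is linear, the reduced
variations are exactly the variations induced by `δq_k = h(δτ_k) + (ξ_k)_Q`
(`reducedVariation_eq_inducedVariation`). Fixed ends correspond to fixed ends, so (B) follows from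
(A).

The analytic input is smoothness: of the discrete lift, from the local inverses of `id × π` on
`Ad.hor`; of the form, from equivariant trivializations; of `L̂`, from local sections of `ρ`. -/

open scoped Manifold ContDiff Topology

namespace DiscreteReduction

/-! ### Evaluation maps on finite product manifolds -/

section PiManifold

variable {𝕜 : Type*} [NontriviallyNormedField 𝕜] {ι : Type*} [Fintype ι]
  {E : ι → Type*} [∀ i, NormedAddCommGroup (E i)] [∀ i, NormedSpace 𝕜 (E i)]
  {H : ι → Type*} [∀ i, TopologicalSpace (H i)] (I : ∀ i, ModelWithCorners 𝕜 (E i) (H i))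
  {M : ι → Type*} [∀ i, TopologicalSpace (M i)] [∀ i, ChartedSpace (H i) (M i)]

/-- The evaluation at `k` on a finite product manifold has as its derivative the evaluation
at `k` of tangent vectors. -/
theorem hasMFDerivAt_pi_apply (x : ∀ i, M i) (k : ι) :
    HasMFDerivAt (ModelWithCorners.pi I) (I k) (fun y : ∀ i, M i => y k) x
      (ContinuousLinearMap.proj k : (∀ i, E i) →L[𝕜] E k) := by
  refine ⟨(continuous_apply k).continuousAt, ?_⟩
  refine (ContinuousLinearMap.hasFDerivAt (𝕜 := 𝕜)
    (ContinuousLinearMap.proj k : (∀ i, E i) →L[𝕜] E k)).hasFDerivWithinAt.congr_of_eventuallyEq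
      ?_ ?_
  -- In charts the evaluation is a chart after its inverse in the `k`-th factor, which is the
  -- identity only on the chart target.
  · filter_upwards [extChartAt_target_mem_nhdsWithin (I := ModelWithCorners.pi I) x] with y hy
    have hk : y k ∈ (extChartAt (I k) (x k)).target := by
      have h₁ := (extChartAt (ModelWithCorners.pi I) x).map_target hy
      have h₂ := (extChartAt (ModelWithCorners.pi I) x).right_inv hy
      rw [← h₂]
      rw [extChartAt_source] at h₁
      exact (extChartAt (I k) (x k)).map_source
        (by rw [extChartAt_source]; exact h₁ k (Set.mem_univ k))
    exact (extChartAt (I k) (x k)).right_inv hk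
  · exact congrArg (extChartAt (I k) (x k))
      ((extChartAt (I k) (x k)).left_inv (mem_extChartAt_source (x k)))

end PiManifold

/-! ### Local sections of submersions -/

section Submersion

open Manifold

variable {𝕜 : Type*} [NontriviallyNormedField 𝕜]
  {E E' F H H' : Type*} [NormedAddCommGroup E] [NormedSpace 𝕜 E] [NormedAddCommGroup E']
  [NormedSpace 𝕜 E'] [NormedAddCommGroup F] [NormedSpace 𝕜 F] [TopologicalSpace H]
  [TopologicalSpace H'] {I : ModelWithCorners 𝕜 E H} {J : ModelWithCorners 𝕜 E' H'}
  {M : Type*} [TopologicalSpace M] [ChartedSpace H M]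
  {N : Type*} [TopologicalSpace N] [ChartedSpace H' N] {n : WithTop ℕ∞}

/-- A submersion from a manifold without boundary has local sections through every point. -/
theorem exists_localSection_of_isSubmersionAt [I.Boundaryless] {f : M → N} {x : M}
    (hf : IsSubmersionAtOfComplement F I J n f x) :
    ∃ s : N → M, ContMDiffAt J I n s (f x) ∧ s (f x) = x ∧ ∀ᶠ y in 𝓝 (f x), f (s y) = y := by
  set φ := hf.domChart.extend I
  set ψ := hf.codChart.extend J
  have hxs : x ∈ φ.source := by
    rw [OpenPartialHomeomorph.extend_source]; exact hf.mem_domChart_source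
  have hφx : φ x ∈ φ.target := φ.map_source hxs
  have hw := hf.writtenInCharts
  have hfx : ψ (f x) = (hf.equiv (φ x)).1 := by
    have := hw hφx
    simp only [Function.comp_apply] at this
    rwa [φ.left_inv hxs] at this
  -- In adapted charts `f` is the projection `E' × F → E'`; the section freezes the `F`-component at
  -- its value at `x`.
  set r : N → E := fun y => hf.equiv.symm (ψ y, (hf.equiv (φ x)).2) with hr
  have hrx : r (f x) = φ x := by simp [hr, hfx]
  have hrs : ContMDiffAt J 𝓘(𝕜, E) n r (f x) := by
    refine (hf.equiv.symm.contDiff.contMDiff.contMDiffAt).comp (f x) (I' := 𝓘(𝕜, E' × F)) ?_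
    exact (hf.codChart.contMDiffAt_extend hf.codChart_mem_maximalAtlas
      hf.mem_codChart_source).prodMk_space contMDiffAt_const
  have hto : φ.target ∈ 𝓝 (φ x) :=
    (hf.domChart.isOpen_extend_target (I := I)).mem_nhds hφx
  have hsym : ContMDiffAt 𝓘(𝕜, E) I n φ.symm (r (f x)) := by
    rw [hrx]
    refine (contMDiffOn_extend_symm hf.domChart_mem_maximalAtlas).contMDiffAt ?_
    rwa [OpenPartialHomeomorph.extend_target'] at hto
  refine ⟨fun y => φ.symm (r y), hsym.comp (f x) hrs, ?_, ?_⟩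
  · simp only [hrx]; exact φ.left_inv hxs
  · have h₁ : ∀ᶠ y in 𝓝 (f x), r y ∈ φ.target := by
      apply hrs.continuousAt; rwa [hrx]
    filter_upwards [h₁, hf.codChart.open_source.mem_nhds hf.mem_codChart_source] with y hy hys
    have h₂ := hw hy
    simp only [Function.comp_apply] at h₂
    have h₃ : (hf.equiv (r y)).1 = ψ y := by simp [hr]
    rw [h₃] at h₂
    refine ψ.injOn ?_ ?_ h₂
    · rw [OpenPartialHomeomorph.extend_source]
      apply hf.mapsto_domChart_source_codChart_source
      rw [← OpenPartialHomeomorph.extend_source (I := I)]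
      exact φ.map_target hy
    · rwa [OpenPartialHomeomorph.extend_source]

end Submersion

/-! ### Differentials of the two actions as sums over the steps of a curve -/

section Mechanics

variable {E : Type*} [NormedAddCommGroup E] [NormedSpace ℝ E]
  {F : Type*} [NormedAddCommGroup F] [NormedSpace ℝ F]
  {M : Type*} [TopologicalSpace M] [ChartedSpace E M]
  {P : Type*} [TopologicalSpace P] [ChartedSpace F P]

/-- Each summand of the action is `L` composed with a pair of evaluations, whose derivatives are
again evaluations. -/
theorem dDiscreteAction_eq_sum {N : ℕ} {L : M × M → ℝ} {q : Fin (N + 1) → M}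
    (hL : ∀ k : Fin N,
      MDifferentiableAt (𝓘(ℝ, E).prod 𝓘(ℝ, E)) 𝓘(ℝ, ℝ) L (q k.castSucc, q k.succ))
    (δq : ∀ k, TangentSpace 𝓘(ℝ, E) (q k)) :
    dDiscreteAction N L q δq = ∑ k : Fin N,
      (mfderiv (𝓘(ℝ, E).prod 𝓘(ℝ, E)) 𝓘(ℝ, ℝ) L (q k.castSucc, q k.succ)
        (pairVec (δq k.castSucc) (δq k.succ)) : ℝ) := by
  have h : ∀ k : Fin N, HasMFDerivAt (ModelWithCorners.pi fun _ : Fin (N + 1) => 𝓘(ℝ, E)) 𝓘(ℝ, ℝ)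
      (fun y : Fin (N + 1) → M => L (y k.castSucc, y k.succ)) q _ := fun k =>
    (hL k).hasMFDerivAt.comp q
      ((hasMFDerivAt_pi_apply (fun _ : Fin (N + 1) => 𝓘(ℝ, E)) q k.castSucc).prodMk
        (hasMFDerivAt_pi_apply (fun _ : Fin (N + 1) => 𝓘(ℝ, E)) q k.succ))
  have hs := (HasMFDerivAt.sum (t := Finset.univ) fun k _ => h k).mfderiv
  have he : (∑ k : Fin N, fun y : Fin (N + 1) → M => L (y k.castSucc, y k.succ))
      = discreteAction N L := by
    ext y; simp [discreteAction]
  rw [he] at hs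
  exact (congrArg (fun T : (Fin (N + 1) → E) →L[ℝ] ℝ => T δq) hs).trans
    (sum_apply (F := (Fin (N + 1) → E) →L[ℝ] ℝ) _ _ _)

theorem dReducedAction_eq_sum {N : ℕ} {L : M × P → ℝ} {c : Fin N → M × P}
    (hL : ∀ k : Fin N, MDifferentiableAt (𝓘(ℝ, E).prod 𝓘(ℝ, F)) 𝓘(ℝ, ℝ) L (c k))
    (δc : ∀ k, TangentSpace (𝓘(ℝ, E).prod 𝓘(ℝ, F)) (c k)) :
    dReducedAction N L c δc = ∑ k : Fin N,
      (mfderiv (𝓘(ℝ, E).prod 𝓘(ℝ, F)) 𝓘(ℝ, ℝ) L (c k) (δc k) : ℝ) := by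
  have h : ∀ k : Fin N,
      HasMFDerivAt (ModelWithCorners.pi fun _ : Fin N => 𝓘(ℝ, E).prod 𝓘(ℝ, F)) 𝓘(ℝ, ℝ)
      (fun y : Fin N → M × P => L (y k)) c _ := fun k =>
    (hL k).hasMFDerivAt.comp c
      (hasMFDerivAt_pi_apply (fun _ : Fin N => 𝓘(ℝ, E).prod 𝓘(ℝ, F)) c k)
  have hs := (HasMFDerivAt.sum (t := Finset.univ) fun k _ => h k).mfderiv
  have he : (∑ k : Fin N, fun y : Fin N → M × P => L (y k)) = reducedAction N L := by
    ext y; simp [reducedAction]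
  rw [he] at hs
  exact (congrArg (fun T : (Fin N → E × F) →L[ℝ] ℝ => T δc) hs).trans
    (sum_apply (F := (Fin N → E × F) →L[ℝ] ℝ) _ _ _)

end Mechanics

/-! ### Smoothness of the discrete connection and of the reduced Lagrangian; the chain rule -/

section Smoothness

variable {E : Type*} [NormedAddCommGroup E] [NormedSpace ℝ E]
  {EG : Type*} [NormedAddCommGroup EG] [NormedSpace ℝ EG]
  {EB : Type*} [NormedAddCommGroup EB] [NormedSpace ℝ EB]
  {G : Type*} [TopologicalSpace G] [ChartedSpace EG G] [Group G]
  {Q : Type*} [TopologicalSpace Q] [ChartedSpace E Q] [MulAction G Q]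
  [ChartedSpace EB (OrbitSpace G Q)]

theorem orbitProj_smul {G Q : Type*} [Group G] [MulAction G Q] (g : G) (q : Q) :
    orbitProj G (g • q) = orbitProj G q :=
  Quotient.sound ⟨g, rfl⟩

namespace AffineDiscreteConnection

variable {Ad : AffineDiscreteConnection E EG EB G Q}

theorem lift_orbitProj_of_mem (hAd : Ad.domain = Set.univ) {q₀ q₁ : Q} (h : (q₀, q₁) ∈ Ad.hor) :
    Ad.lift q₀ (orbitProj G q₁) = q₁ := by
  have h₁ := lift_spec hAd q₀ (orbitProj G q₁)
  exact congrArg Prod.snd (Ad.injOn h₁.1 h (by simp only [h₁.2]))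

theorem form_spec (hAd : Ad.domain = Set.univ) (q₀ q₁ : Q) :
    (q₀, (Ad.form (q₀, q₁))⁻¹ • q₁) ∈ Ad.hor := by
  refine Classical.epsilon_spec (p := fun g : G => (q₀, g⁻¹ • q₁) ∈ Ad.hor) ?_
  obtain ⟨g, x, hx, h⟩ : (q₀, q₁) ∈ Ad.domain := hAd ▸ Set.mem_univ _
  refine ⟨g, ?_⟩
  simp only at h
  rwa [h, inv_smul_smul]

/-- Translating `q₁` by the inverse of the form gives a horizontal partner of `q₀` in the fibre of
`q₁`; by injectivity of `id × π` on `Ad.hor` it is the lift. -/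
theorem form_smul_lift (hAd : Ad.domain = Set.univ) (q₀ q₁ : Q) :
    Ad.form (q₀, q₁) • Ad.lift q₀ (orbitProj G q₁) = q₁ := by
  have h := lift_orbitProj_of_mem hAd (form_spec hAd q₀ q₁)
  rw [orbitProj_smul] at h
  rw [h, smul_inv_smul]

/-- The discrete horizontal lift is smooth in both arguments. -/
theorem contMDiff_lift [IsManifold 𝓘(ℝ, E) ∞ Q] (hAd : Ad.domain = Set.univ) :
    ContMDiff (𝓘(ℝ, E).prod 𝓘(ℝ, EB)) 𝓘(ℝ, E) ∞
      (fun p : Q × OrbitSpace G Q => Ad.lift p.1 p.2) := by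
  obtain ⟨d, _, -, hemb, hloc⟩ := Ad.submanifold
  rintro ⟨q₀, τ⟩
  have hp := lift_spec hAd q₀ τ
  let p : Ad.hor := ⟨(q₀, Ad.lift q₀ τ), hp.1⟩
  have hl := hloc p
  have hfp : (p.1.1, orbitProj G p.1.2) = (q₀, τ) := by simp only [p, hp.2]
  have h₁ := hl.localInverse_contMDiffAt
  have h₂ := hl.localInverse_eventuallyEq_right
  rw [hfp] at h₁ h₂
  have h₃ : ContMDiff 𝓘(ℝ, EuclideanSpace ℝ (Fin d)) (𝓘(ℝ, E).prod 𝓘(ℝ, E)) ∞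
      (Subtype.val : Ad.hor → Q × Q) := hemb.isImmersion.contMDiff
  -- Near `(q₀, τ)` the lift is the second component of the local inverse of `id × π` on `Ad.hor`,
  -- by uniqueness of the horizontal point over `τ`.
  refine ((contMDiff_snd.comp h₃).contMDiffAt.comp (q₀, τ) h₁).congr_of_eventuallyEq ?_
  filter_upwards [h₂] with x hx
  have hx' : ((hl.localInverse x).1.1, orbitProj G (hl.localInverse x).1.2) = x := hx
  have h₄ := lift_orbitProj_of_mem hAd (hl.localInverse x).2
  rw [← hx']
  rw [h₄, hx']
  rfl

/-- The affine discrete connection form is smooth. -/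
theorem contMDiff_form [IsManifold 𝓘(ℝ, E) ∞ Q] [LieGroup 𝓘(ℝ, EG) ∞ G]
    (hπ : IsSmoothPrincipalBundle E EG EB G Q) (hAd : Ad.domain = Set.univ) :
    ContMDiff (𝓘(ℝ, E).prod 𝓘(ℝ, E)) 𝓘(ℝ, EG) ∞ Ad.form := by
  rintro ⟨q₀, q₁⟩
  obtain ⟨e, hb, he, -, heq⟩ := hπ.2 (orbitProj G q₁)
  have hℓ : ContMDiff (𝓘(ℝ, E).prod 𝓘(ℝ, E)) 𝓘(ℝ, E) ∞
      (fun p : Q × Q => Ad.lift p.1 (orbitProj G p.2)) :=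
    (contMDiff_lift hAd).comp (contMDiff_fst.prodMk (hπ.1.comp contMDiff_snd))
  have hq₁ : q₁ ∈ e.source := e.mem_source.2 hb
  have hs : ∀ p : Q × Q, p.2 ∈ e.source → Ad.lift p.1 (orbitProj G p.2) ∈ e.source := by
    intro p hp
    rw [e.mem_source] at hp ⊢
    rwa [(lift_spec hAd p.1 _).2]
  have he₂ : ∀ x ∈ e.source, ContMDiffAt 𝓘(ℝ, E) 𝓘(ℝ, EG) ∞ (fun x => (e x).2) x := fun x hx =>
    contMDiff_snd.contMDiffAt.comp x (he.contMDiffAt (e.open_source.mem_nhds hx))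
  -- A point and its lift share a fibre, hence a trivialization. Equivariance makes the form the
  -- quotient of their `G`-coordinates.
  have h₁ : ContMDiffAt (𝓘(ℝ, E).prod 𝓘(ℝ, E)) 𝓘(ℝ, EG) ∞
      (fun p : Q × Q => (e p.2).2 * ((e (Ad.lift p.1 (orbitProj G p.2))).2)⁻¹) (q₀, q₁) := by
    refine ContMDiffAt.mul ?_ (ContMDiffAt.inv ?_)
    · exact ContMDiffAt.comp (g := fun x => (e x).2) (f := Prod.snd) (q₀, q₁) (he₂ q₁ hq₁)
        contMDiffAt_snd
    · exact ContMDiffAt.comp (g := fun x => (e x).2) (q₀, q₁) (he₂ _ (hs (q₀, q₁) hq₁))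
        hℓ.contMDiffAt
  refine h₁.congr_of_eventuallyEq ?_
  filter_upwards [(e.open_source.preimage continuous_snd).mem_nhds hq₁] with p hp
  rw [eq_mul_inv_iff_mul_eq, ← heq _ _ (hs p hp), form_smul_lift hAd]

variable {L : Q × Q → ℝ} {hL : ∀ (g : G) (q₀ q₁ : Q), L (g • q₀, g • q₁) = L (q₀, q₁)}

theorem reducedLagrangian_reduce (hAd : Ad.domain = Set.univ) (p : Q × Q) :
    Ad.reducedLagrangian hAd L hL (reduce Ad p) = L p := by
  change L (p.1, Ad.form p • Ad.lift p.1 (orbitProj G p.2)) = L p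
  rw [form_smul_lift hAd p.1 p.2]

variable {EC : Type*} [NormedAddCommGroup EC] [NormedSpace ℝ EC]
  [ChartedSpace EC (ConjBundle G Q)]

/-- The reduced Lagrangian is smooth. -/
theorem contMDiff_reducedLagrangian [IsManifold 𝓘(ℝ, E) ∞ Q]
    [ContMDiffSMul 𝓘(ℝ, EG) 𝓘(ℝ, E) ∞ G Q]
    (hρ : Manifold.IsSubmersion (𝓘(ℝ, E).prod 𝓘(ℝ, EG)) 𝓘(ℝ, EC) ∞
      (conjProj : Q × G → ConjBundle G Q))
    (hLs : ContMDiff (𝓘(ℝ, E).prod 𝓘(ℝ, E)) 𝓘(ℝ, ℝ) ∞ L) (hAd : Ad.domain = Set.univ) :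
    ContMDiff (𝓘(ℝ, EC).prod 𝓘(ℝ, EB)) 𝓘(ℝ, ℝ) ∞ (Ad.reducedLagrangian hAd L hL) := by
  rintro ⟨v, τ⟩
  obtain ⟨x, rfl⟩ := Quotient.exists_rep v
  obtain ⟨F, _, _, hρF⟩ := hρ
  -- A local section of `ρ` chooses representatives smoothly, so that `L̂` is locally a composite of
  -- smooth maps.
  obtain ⟨s, hs, -, hsec⟩ := exists_localSection_of_isSubmersionAt (hρF x)
  have hσ : ContMDiffAt (𝓘(ℝ, EC).prod 𝓘(ℝ, EB)) (𝓘(ℝ, E).prod 𝓘(ℝ, EG)) ∞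
      (fun y : ConjBundle G Q × OrbitSpace G Q => s y.1) (conjProj x, τ) :=
    hs.comp (conjProj x, τ) contMDiffAt_fst
  have hσ₁ := contMDiff_fst.contMDiffAt.comp (conjProj x, τ) hσ
  have hσ₂ := contMDiff_snd.contMDiffAt.comp (conjProj x, τ) hσ
  have hlift := (contMDiff_lift hAd).contMDiffAt.comp (conjProj x, τ) (hσ₁.prodMk contMDiffAt_snd)
  have hsm := (contMDiff_smul (I := 𝓘(ℝ, EG)) (I' := 𝓘(ℝ, E)) (n := ∞) (G := G)
    (M := Q)).contMDiffAt.comp (conjProj x, τ) (hσ₂.prodMk hlift)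
  refine (hLs.contMDiffAt.comp (conjProj x, τ) (hσ₁.prodMk hsm)).congr_of_eventuallyEq ?_
  have h : ∀ᶠ y : ConjBundle G Q × OrbitSpace G Q in 𝓝 (conjProj x, τ), conjProj (s y.1) = y.1 :=
    (continuous_fst.tendsto (conjProj x, τ)).eventually hsec
  filter_upwards [h] with y hy
  -- Exposing the representative `s y.1` lets `Quotient.lift` compute, so the final `rfl` closes the
  -- goal.
  have : Ad.reducedLagrangian hAd L hL y = Ad.reducedLagrangian hAd L hL (conjProj (s y.1), y.2) := by
    rw [hy]
  rw [this]
  rfl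

/-- Identifies induced variations as values of one linear map, the derivative of `Υ`; both the
additivity of `pushConj` and the chain rule rest on it. -/
theorem hasMFDerivAt_reduce [IsManifold 𝓘(ℝ, E) ∞ Q] [LieGroup 𝓘(ℝ, EG) ∞ G]
    (hπ : IsSmoothPrincipalBundle E EG EB G Q)
    (hρ : ContMDiff (𝓘(ℝ, E).prod 𝓘(ℝ, EG)) 𝓘(ℝ, EC) ∞ (conjProj : Q × G → ConjBundle G Q))
    (hAd : Ad.domain = Set.univ) (q₀ q₁ : Q) :
    ∃ T : E × E →L[ℝ] EC × EB,
      HasMFDerivAt (𝓘(ℝ, E).prod 𝓘(ℝ, E)) (𝓘(ℝ, EC).prod 𝓘(ℝ, EB)) (reduce Ad) (q₀, q₁) T ∧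
      ∀ (u : TangentSpace 𝓘(ℝ, E) q₀) (v : TangentSpace 𝓘(ℝ, E) q₁),
        T ((u, v) : E × E) = ((pushConj EC Ad u v,
          mfderiv 𝓘(ℝ, E) 𝓘(ℝ, EB) (orbitProj G : Q → OrbitSpace G Q) q₁ v) : EC × EB) := by
  have hn : (∞ : WithTop ℕ∞) ≠ 0 := by simp
  have hf := ((contMDiff_form hπ hAd).mdifferentiableAt hn (x := (q₀, q₁))).hasMFDerivAt
  have hr := (hρ.mdifferentiableAt hn (x := (q₀, Ad.form (q₀, q₁)))).hasMFDerivAt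
  have hp := (hπ.1.mdifferentiableAt hn (x := q₁)).hasMFDerivAt
  have h₁ : HasMFDerivAt (𝓘(ℝ, E).prod 𝓘(ℝ, E)) 𝓘(ℝ, E) (Prod.fst : Q × Q → Q) (q₀, q₁) _ :=
    hasMFDerivAt_fst _
  have h₂ : HasMFDerivAt (𝓘(ℝ, E).prod 𝓘(ℝ, E)) 𝓘(ℝ, E) (Prod.snd : Q × Q → Q) (q₀, q₁) _ :=
    hasMFDerivAt_snd _
  exact ⟨_, (hr.comp (q₀, q₁) (h₁.prodMk hf)).prodMk (hp.comp (q₀, q₁) h₂), fun u v => rfl⟩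

theorem pushConj_add [IsManifold 𝓘(ℝ, E) ∞ Q] [LieGroup 𝓘(ℝ, EG) ∞ G]
    (hπ : IsSmoothPrincipalBundle E EG EB G Q)
    (hρ : ContMDiff (𝓘(ℝ, E).prod 𝓘(ℝ, EG)) 𝓘(ℝ, EC) ∞ (conjProj : Q × G → ConjBundle G Q))
    (hAd : Ad.domain = Set.univ) (q₀ q₁ : Q) (u u' : TangentSpace 𝓘(ℝ, E) q₀)
    (v v' : TangentSpace 𝓘(ℝ, E) q₁) :
    pushConj EC Ad (u + u') (v + v') = pushConj EC Ad u v + pushConj EC Ad u' v' := by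
  obtain ⟨T, -, hT⟩ := hasMFDerivAt_reduce hπ hρ hAd q₀ q₁
  have h := T.map_add ((u, v) : E × E) ((u', v') : E × E)
  rw [hT, hT] at h
  exact (congrArg Prod.fst (hT (u + u') (v + v'))).symm.trans (congrArg Prod.fst h)

/-- The chain rule for `L_d = L̂_d ∘ Υ`. -/
theorem mfderiv_reducedLagrangian_pushConj [IsManifold 𝓘(ℝ, E) ∞ Q] [LieGroup 𝓘(ℝ, EG) ∞ G]
    [ContMDiffSMul 𝓘(ℝ, EG) 𝓘(ℝ, E) ∞ G Q]
    [IsManifold 𝓘(ℝ, EC) ∞ (ConjBundle G Q)]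
    (hπ : IsSmoothPrincipalBundle E EG EB G Q)
    (hρ : Manifold.IsSubmersion (𝓘(ℝ, E).prod 𝓘(ℝ, EG)) 𝓘(ℝ, EC) ∞
      (conjProj : Q × G → ConjBundle G Q))
    (hLs : ContMDiff (𝓘(ℝ, E).prod 𝓘(ℝ, E)) 𝓘(ℝ, ℝ) ∞ L) (hAd : Ad.domain = Set.univ)
    (q₀ q₁ : Q) (u : TangentSpace 𝓘(ℝ, E) q₀) (v : TangentSpace 𝓘(ℝ, E) q₁) :
    mfderiv (𝓘(ℝ, E).prod 𝓘(ℝ, E)) 𝓘(ℝ, ℝ) L (q₀, q₁) (pairVec u v) =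
      (mfderiv (𝓘(ℝ, EC).prod 𝓘(ℝ, EB)) 𝓘(ℝ, ℝ) (Ad.reducedLagrangian hAd L hL)
        (reduce Ad (q₀, q₁)) (pairVec (pushConj EC Ad u v)
          (mfderiv 𝓘(ℝ, E) 𝓘(ℝ, EB) (orbitProj G : Q → OrbitSpace G Q) q₁ v)) : ℝ) := by
  obtain ⟨T, hT, hTuv⟩ := hasMFDerivAt_reduce hπ hρ.contMDiff hAd q₀ q₁
  have h := ((contMDiff_reducedLagrangian (hL := hL) hρ hLs hAd).mdifferentiableAt (by simp)
    (x := reduce Ad (q₀, q₁))).hasMFDerivAt.comp (q₀, q₁) hT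
  have he : Ad.reducedLagrangian hAd L hL ∘ reduce Ad = L :=
    funext (reducedLagrangian_reduce hAd)
  rw [he] at h
  rw [h.mfderiv]
  exact congrArg (mfderiv (𝓘(ℝ, EC).prod 𝓘(ℝ, EB)) 𝓘(ℝ, ℝ) (Ad.reducedLagrangian hAd L hL)
    (reduce Ad (q₀, q₁))) (hTuv u v)

end AffineDiscreteConnection

end Smoothness

/-! ### Vertical vectors, horizontal lifts and the splitting of tangent vectors -/

section Vertical

variable {E : Type*} [NormedAddCommGroup E] [NormedSpace ℝ E]
  {EG : Type*} [NormedAddCommGroup EG] [NormedSpace ℝ EG]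
  {EB : Type*} [NormedAddCommGroup EB] [NormedSpace ℝ EB]
  {G : Type*} [TopologicalSpace G] [ChartedSpace EG G] [Group G]
  {Q : Type*} [TopologicalSpace Q] [ChartedSpace E Q] [MulAction G Q]

theorem infGen_zero (q : Q) : infGen (E := E) (0 : GroupLieAlgebra 𝓘(ℝ, EG) G) q = 0 :=
  map_zero (mfderiv 𝓘(ℝ, EG) 𝓘(ℝ, E) (fun g : G => g • q) 1)

variable [ContMDiffSMul 𝓘(ℝ, EG) 𝓘(ℝ, E) ∞ G Q]

theorem hasMFDerivAt_orbitMap (q : Q) :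
    HasMFDerivAt 𝓘(ℝ, EG) 𝓘(ℝ, E) (fun g : G => g • q) 1
      (mfderiv 𝓘(ℝ, EG) 𝓘(ℝ, E) (fun g : G => g • q) 1) := by
  have h : ContMDiff 𝓘(ℝ, EG) 𝓘(ℝ, E) ∞ (fun g : G => g • q) :=
    (contMDiff_smul (I := 𝓘(ℝ, EG)) (I' := 𝓘(ℝ, E)) (n := ∞) (G := G) (M := Q)).comp
      (contMDiff_id.prodMk contMDiff_const)
  exact (h.mdifferentiableAt (by simp)).hasMFDerivAt

variable [ChartedSpace EB (OrbitSpace G Q)]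

/-- The projection of a principal bundle maps infinitesimal generators to zero. -/
theorem mfderiv_orbitProj_infGen (hπ : IsSmoothPrincipalBundle E EG EB G Q)
    (ξ : GroupLieAlgebra 𝓘(ℝ, EG) G) (q : Q) :
    mfderiv 𝓘(ℝ, E) 𝓘(ℝ, EB) (orbitProj G : Q → OrbitSpace G Q) q (infGen ξ q) = 0 := by
  have h₁ : HasMFDerivAt 𝓘(ℝ, E) 𝓘(ℝ, EB) (orbitProj G : Q → OrbitSpace G Q) ((1 : G) • q)
      (mfderiv 𝓘(ℝ, E) 𝓘(ℝ, EB) (orbitProj G : Q → OrbitSpace G Q) q : E →L[ℝ] EB) := by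
    rw [one_smul]
    exact (hπ.1.mdifferentiableAt (by simp)).hasMFDerivAt
  have h₂ := h₁.comp 1 (hasMFDerivAt_orbitMap (EG := EG) q)
  -- The projection is constant along orbits, so the composite has zero derivative.
  have h₃ : (orbitProj G : Q → OrbitSpace G Q) ∘ (fun g : G => g • q) =
      fun _ => orbitProj G q := funext fun g => orbitProj_smul g q
  rw [h₃] at h₂
  have h₄ := hasMFDerivAt_unique h₂ (hasMFDerivAt_const (I := 𝓘(ℝ, EG)) (I' := 𝓘(ℝ, EB))
    (orbitProj G q) (1 : G))
  exact congrArg (fun T : EG →L[ℝ] EB => T ξ) h₄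

variable [LieGroup 𝓘(ℝ, EG) ∞ G]

/-- A right translation of a Lie group has a surjective differential at the identity. -/
theorem exists_hasMFDerivAt_mul_right_surjective (h : G) :
    ∃ T : EG →L[ℝ] EG, HasMFDerivAt 𝓘(ℝ, EG) 𝓘(ℝ, EG) (fun g : G => g * h) 1 T ∧
      Function.Surjective T := by
  have h₁ : HasMFDerivAt 𝓘(ℝ, EG) 𝓘(ℝ, EG) (fun g : G => g * h) 1 _ :=
    ((contMDiff_mul_right (I := 𝓘(ℝ, EG)) (n := ∞) (a := h)).mdifferentiableAt
      (by simp)).hasMFDerivAt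
  have h₂ : HasMFDerivAt 𝓘(ℝ, EG) 𝓘(ℝ, EG) (fun g : G => g * h⁻¹) h _ :=
    ((contMDiff_mul_right (I := 𝓘(ℝ, EG)) (n := ∞) (a := h⁻¹)).mdifferentiableAt
      (by simp)).hasMFDerivAt
  obtain ⟨T, hT⟩ : ∃ T : EG →L[ℝ] EG,
      HasMFDerivAt 𝓘(ℝ, EG) 𝓘(ℝ, EG) (fun g : G => g * h) 1 T := ⟨_, h₁⟩
  -- Translation by `h⁻¹`, differentiated at `h`, supplies a right inverse of `T`.
  refine ⟨T, hT, fun η => ⟨mfderiv 𝓘(ℝ, EG) 𝓘(ℝ, EG) (fun g : G => g * h⁻¹) h η, ?_⟩⟩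
  have hT' : HasMFDerivAt 𝓘(ℝ, EG) 𝓘(ℝ, EG) (fun g : G => g * h) (h * h⁻¹) T := by
    rwa [mul_inv_cancel]
  have h₃ := hT'.comp h h₂
  have h₄ : (fun g : G => g * h) ∘ (fun g : G => g * h⁻¹) = id := by
    ext g; simp
  rw [h₄] at h₃
  exact congrArg (fun T : EG →L[ℝ] EG => T η) (hasMFDerivAt_unique h₃ (hasMFDerivAt_id h))

/-- The differential of an equivariant local trivialization, as a linear isomorphism. -/
theorem exists_mfderiv_trivialization (hπ : IsSmoothPrincipalBundle E EG EB G Q) (q : Q) :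
    ∃ (h : G) (T : E →L[ℝ] EB × EG) (R : EG →L[ℝ] EG), Function.Bijective T ∧
      HasMFDerivAt 𝓘(ℝ, EG) 𝓘(ℝ, EG) (fun g : G => g * h) 1 R ∧
      (∀ v : TangentSpace 𝓘(ℝ, E) q, (T v).1 =
        (mfderiv 𝓘(ℝ, E) 𝓘(ℝ, EB) (orbitProj G : Q → OrbitSpace G Q) q v : EB)) ∧
      ∀ ξ : GroupLieAlgebra 𝓘(ℝ, EG) G, (T (infGen (E := E) ξ q : E)).2 = R ξ := by
  have hn : (∞ : WithTop ℕ∞) ≠ 0 := by simp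
  obtain ⟨e, hb, he, hs, heq⟩ := hπ.2 (orbitProj G q)
  have hq : q ∈ e.source := e.mem_source.2 hb
  have hsrc : e.source ∈ 𝓝 q := e.open_source.mem_nhds hq
  have htgt : e.target ∈ 𝓝 (e q) := e.open_target.mem_nhds (e.map_source hq)
  obtain ⟨T, hT⟩ : ∃ T : E →L[ℝ] EB × EG,
      HasMFDerivAt 𝓘(ℝ, E) (𝓘(ℝ, EB).prod 𝓘(ℝ, EG)) e q T :=
    ⟨_, ((he.contMDiffAt hsrc).mdifferentiableAt hn).hasMFDerivAt⟩
  obtain ⟨S, hS⟩ : ∃ S : EB × EG →L[ℝ] E,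
      HasMFDerivAt (𝓘(ℝ, EB).prod 𝓘(ℝ, EG)) 𝓘(ℝ, E) e.toOpenPartialHomeomorph.symm (e q) S :=
    ⟨_, ((hs.contMDiffAt htgt).mdifferentiableAt hn).hasMFDerivAt⟩
  have hsq : e.toOpenPartialHomeomorph.symm (e q) = q := e.toOpenPartialHomeomorph.left_inv hq
  have hST : S.comp T = ContinuousLinearMap.id ℝ E := by
    refine hasMFDerivAt_unique (hS.comp q hT) ((hasMFDerivAt_id q).congr_of_eventuallyEq ?_)
    filter_upwards [hsrc] with x hx using e.toOpenPartialHomeomorph.left_inv hx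
  have hTS : T.comp S = ContinuousLinearMap.id ℝ (EB × EG) := by
    have hT' : HasMFDerivAt 𝓘(ℝ, E) (𝓘(ℝ, EB).prod 𝓘(ℝ, EG)) e
      (e.toOpenPartialHomeomorph.symm (e q)) T := by rwa [hsq]
    refine hasMFDerivAt_unique (hT'.comp (e q) hS)
      ((hasMFDerivAt_id (e q)).congr_of_eventuallyEq ?_)
    filter_upwards [htgt] with x hx using e.toOpenPartialHomeomorph.right_inv hx
  obtain ⟨R, hR, -⟩ := exists_hasMFDerivAt_mul_right_surjective (EG := EG) (e q).2
  refine ⟨(e q).2, T, R, ⟨?_, ?_⟩, hR, fun v => ?_, fun ξ => ?_⟩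
  · exact Function.LeftInverse.injective (g := S) fun x => congrArg (fun A : E →L[ℝ] E => A x) hST
  · exact Function.RightInverse.surjective (g := S) fun x =>
      congrArg (fun A : EB × EG →L[ℝ] EB × EG => A x) hTS
  · have h₁ := (hasMFDerivAt_fst (I := 𝓘(ℝ, EB)) (I' := 𝓘(ℝ, EG)) (e q)).comp q hT
    have h₂ := h₁.congr_of_eventuallyEq (f₁ := (orbitProj G : Q → OrbitSpace G Q)) (by
      filter_upwards [hsrc] with x hx using (e.coe_fst hx).symm)
    rw [h₂.mfderiv]
    rfl
  · have hT' : HasMFDerivAt 𝓘(ℝ, E) (𝓘(ℝ, EB).prod 𝓘(ℝ, EG)) e ((1 : G) • q) T := by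
      rwa [one_smul]
    have h₁ := hT'.comp 1 (hasMFDerivAt_orbitMap (EG := EG) q)
    have h₂ := (hasMFDerivAt_snd (I := 𝓘(ℝ, EB)) (I' := 𝓘(ℝ, EG)) (e ((1 : G) • q))).comp 1 h₁
    -- By equivariance, the orbit map followed by the `G`-coordinate is a right translation; this
    -- fixes `R`.
    have h₃ : Prod.snd ∘ e ∘ (fun g : G => g • q) = fun g => g * (e q).2 :=
      funext fun g => heq g q hq
    rw [h₃] at h₂
    exact congrArg (fun A : EG →L[ℝ] EG => A ξ) (hasMFDerivAt_unique h₂ hR)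

theorem mfderiv_orbitProj_surjective (hπ : IsSmoothPrincipalBundle E EG EB G Q) (q : Q) :
    Function.Surjective
      (mfderiv 𝓘(ℝ, E) 𝓘(ℝ, EB) (orbitProj G : Q → OrbitSpace G Q) q) := by
  obtain ⟨-, T, -, hT, -, hTπ, -⟩ := exists_mfderiv_trivialization hπ q
  intro w
  obtain ⟨v, hv⟩ := hT.2 ((w, 0) : EB × EG)
  exact ⟨v, (hTπ v).symm.trans (congrArg Prod.fst hv)⟩

/-- The kernel of the differential of the projection consists of infinitesimal generators. -/
theorem exists_infGen_eq (hπ : IsSmoothPrincipalBundle E EG EB G Q) {q : Q}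
    {v : TangentSpace 𝓘(ℝ, E) q}
    (hv : mfderiv 𝓘(ℝ, E) 𝓘(ℝ, EB) (orbitProj G : Q → OrbitSpace G Q) q v = 0) :
    ∃ ξ : GroupLieAlgebra 𝓘(ℝ, EG) G, infGen ξ q = v := by
  obtain ⟨h, T, R, hT, hR, hTπ, hTξ⟩ := exists_mfderiv_trivialization hπ q
  obtain ⟨R', hR', hsurj⟩ := exists_hasMFDerivAt_mul_right_surjective (EG := EG) h
  obtain rfl : R = R' := hasMFDerivAt_unique hR hR'
  -- Match the `G`-component of `T v`; the base components of both vectors vanish, and `T` is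
  -- injective.
  obtain ⟨ξ, hξ⟩ := hsurj (T v).2
  refine ⟨ξ, hT.1 (Prod.ext ?_ ((hTξ ξ).trans hξ))⟩
  rw [hTπ v, hv]
  exact (hTπ _).trans (mfderiv_orbitProj_infGen hπ ξ q)

namespace PrincipalConnection

variable [IsManifold 𝓘(ℝ, E) ∞ Q] (A : PrincipalConnection E EG G Q)

/-- Any preimage of `w` under the surjective `Tπ` splits into vertical and horizontal parts, and the
vertical part is killed. -/
theorem lift_spec (hπ : IsSmoothPrincipalBundle E EG EB G Q) (q : Q)
    (w : TangentSpace 𝓘(ℝ, EB) (orbitProj G q)) :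
    A.lift q w ∈ A.hor q ∧
      mfderiv 𝓘(ℝ, E) 𝓘(ℝ, EB) (orbitProj G : Q → OrbitSpace G Q) q (A.lift q w) = w := by
  refine Classical.epsilon_spec (p := fun v => v ∈ A.hor q ∧
    mfderiv 𝓘(ℝ, E) 𝓘(ℝ, EB) (orbitProj G : Q → OrbitSpace G Q) q v = w) ?_
  obtain ⟨v, rfl⟩ := mfderiv_orbitProj_surjective hπ q w
  have hv : v ∈ verticalSpace E EG G q ⊔ A.hor q := by
    rw [(A.isCompl q).sup_eq_top]; trivial
  obtain ⟨_, ⟨ξ, rfl⟩, y, hy, rfl⟩ := Submodule.mem_sup.1 hv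
  refine ⟨y, hy, ?_⟩
  rw [map_add]
  exact (zero_add _).symm.trans
    (congrArg (· + _) (mfderiv_orbitProj_infGen hπ ξ q).symm)

/-- The lift of zero lies in the kernel of `Tπ`, so it is vertical as well as horizontal. Needed to
match the fixed-end conditions. -/
theorem lift_zero (hπ : IsSmoothPrincipalBundle E EG EB G Q) (q : Q) :
    A.lift q (0 : TangentSpace 𝓘(ℝ, EB) (orbitProj G q)) = 0 := by
  obtain ⟨h₁, h₂⟩ := A.lift_spec hπ q (0 : TangentSpace 𝓘(ℝ, EB) (orbitProj G q))
  obtain ⟨ξ, hξ⟩ := exists_infGen_eq hπ h₂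
  exact Submodule.disjoint_def.1 (A.isCompl q).disjoint _ ⟨ξ, hξ⟩ h₁

/-- Every tangent vector is the sum of the horizontal lift of its projection and of an
infinitesimal generator. -/
theorem exists_eq_lift_add_infGen (hπ : IsSmoothPrincipalBundle E EG EB G Q) {q : Q}
    (v : TangentSpace 𝓘(ℝ, E) q) :
    ∃ ξ : GroupLieAlgebra 𝓘(ℝ, EG) G,
      A.lift q (mfderiv 𝓘(ℝ, E) 𝓘(ℝ, EB) (orbitProj G : Q → OrbitSpace G Q) q v)
        + infGen ξ q = v := by
  obtain ⟨ξ, hξ⟩ := exists_infGen_eq hπ (q := q)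
    (v := v - A.lift q (mfderiv 𝓘(ℝ, E) 𝓘(ℝ, EB) (orbitProj G : Q → OrbitSpace G Q) q v))
    (by rw [map_sub, (A.lift_spec hπ q _).2, sub_self])
  exact ⟨ξ, by rw [hξ, add_sub_cancel]⟩

end PrincipalConnection

/-- Reduced variations are the variations induced by `δq_k = h(δτ_k) + (ξ_k)_Q`. -/
theorem reducedVariation_eq_inducedVariation
    {EC : Type*} [NormedAddCommGroup EC] [NormedSpace ℝ EC] [ChartedSpace EC (ConjBundle G Q)]
    [IsManifold 𝓘(ℝ, E) ∞ Q]
    (hπ : IsSmoothPrincipalBundle E EG EB G Q)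
    (hρ : ContMDiff (𝓘(ℝ, E).prod 𝓘(ℝ, EG)) 𝓘(ℝ, EC) ∞ (conjProj : Q × G → ConjBundle G Q))
    {Ad : AffineDiscreteConnection E EG EB G Q} (hAd : Ad.domain = Set.univ)
    (A : PrincipalConnection E EG G Q) {N : ℕ} (q : Fin (N + 1) → Q)
    (δτ : ∀ k, TangentSpace 𝓘(ℝ, EB) (orbitProj G (q k) : OrbitSpace G Q))
    (ξ : Fin (N + 1) → GroupLieAlgebra 𝓘(ℝ, EG) G) :
    reducedVariation EC Ad A q δτ ξ =
      inducedVariation EC Ad q (fun k => A.lift (q k) (δτ k) + infGen (ξ k) (q k)) := by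
  funext k
  unfold reducedVariation inducedVariation
  rw [AffineDiscreteConnection.pushConj_add hπ hρ hAd, map_add, (A.lift_spec hπ _ _).2,
    mfderiv_orbitProj_infGen hπ, add_zero]

end Vertical

end DiscreteReduction

/-! ### The theorem -/

open DiscreteReduction in
theorem mainTheorem2
    {E EG EB EC : Type*}
    [NormedAddCommGroup E] [NormedSpace ℝ E] [FiniteDimensional ℝ E]
    [NormedAddCommGroup EG] [NormedSpace ℝ EG] [FiniteDimensional ℝ EG]
    [NormedAddCommGroup EB] [NormedSpace ℝ EB] [FiniteDimensional ℝ EB]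
    [NormedAddCommGroup EC] [NormedSpace ℝ EC] [FiniteDimensional ℝ EC]
    -- the Lie group `G` and the configuration manifold `Q`
    {G Q : Type*}
    [TopologicalSpace G] [ChartedSpace EG G] [T2Space G] [SecondCountableTopology G]
    [Group G] [LieGroup 𝓘(ℝ, EG) ∞ G]
    [TopologicalSpace Q] [ChartedSpace E Q] [T2Space Q] [SecondCountableTopology Q]
    [IsManifold 𝓘(ℝ, E) ∞ Q]
    -- a smooth, free and proper action; `Q/G` carries the smooth structure that makes `π` a principal
    -- bundle, `G̃` the one that makes `ρ` a submersion
    [MulAction G Q] [ContMDiffSMul 𝓘(ℝ, EG) 𝓘(ℝ, E) ∞ G Q] [IsCancelSMul G Q] [ProperSMul G Q]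
    [ChartedSpace EB (OrbitSpace G Q)] [IsManifold 𝓘(ℝ, EB) ∞ (OrbitSpace G Q)]
    (hπ : IsSmoothPrincipalBundle E EG EB G Q)
    [ChartedSpace EC (ConjBundle G Q)] [IsManifold 𝓘(ℝ, EC) ∞ (ConjBundle G Q)]
    (hρ : Manifold.IsSubmersion (𝓘(ℝ, E).prod 𝓘(ℝ, EG)) 𝓘(ℝ, EC) ∞
      (conjProj : Q × G → ConjBundle G Q))
    -- a `G`-invariant discrete Lagrangian
    (L : Q × Q → ℝ) (hLsmooth : ContMDiff (𝓘(ℝ, E).prod 𝓘(ℝ, E)) 𝓘(ℝ, ℝ) ∞ L)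
    (hL : ∀ (g : G) (q₀ q₁ : Q), L (g • q₀, g • q₁) = L (q₀, q₁))
    -- a globally defined affine discrete connection, and a principal connection
    (Ad : AffineDiscreteConnection E EG EB G Q) (hAd : Ad.domain = Set.univ)
    (A : PrincipalConnection E EG G Q)
    (N : ℕ) (q : Fin (N + 1) → Q) :
    (∀ δq : ∀ k, TangentSpace 𝓘(ℝ, E) (q k),
      dDiscreteAction N L q δq =
        dReducedAction N (Ad.reducedLagrangian hAd L hL) (reducedCurve Ad q)
          (inducedVariation EC Ad q δq)) ∧
    ((∀ δq : ∀ k, TangentSpace 𝓘(ℝ, E) (q k),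
        δq 0 = 0 → δq (Fin.last N) = 0 → dDiscreteAction N L q δq = 0) ↔
      ∀ (δτ : ∀ k, TangentSpace 𝓘(ℝ, EB) (orbitProj G (q k)))
        (ξ : Fin (N + 1) → GroupLieAlgebra 𝓘(ℝ, EG) G),
        δτ 0 = 0 → δτ (Fin.last N) = 0 → ξ 0 = 0 → ξ (Fin.last N) = 0 →
        dReducedAction N (Ad.reducedLagrangian hAd L hL) (reducedCurve Ad q)
          (reducedVariation EC Ad A q δτ ξ) = 0) := by
  have hA : ∀ δq : ∀ k, TangentSpace 𝓘(ℝ, E) (q k),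
      dDiscreteAction N L q δq =
        dReducedAction N (Ad.reducedLagrangian hAd L hL) (reducedCurve Ad q)
          (inducedVariation EC Ad q δq) := by
    intro δq
    rw [dDiscreteAction_eq_sum fun k => hLsmooth.mdifferentiableAt (by simp),
      dReducedAction_eq_sum fun k =>
        (AffineDiscreteConnection.contMDiff_reducedLagrangian hρ hLsmooth hAd).mdifferentiableAt
          (by simp)]
    exact Finset.sum_congr rfl fun k _ =>
      AffineDiscreteConnection.mfderiv_reducedLagrangian_pushConj hπ hρ hLsmooth hAd _ _ _ _
  refine ⟨hA, fun h δτ ξ hτ₀ hτN hξ₀ hξN => ?_, fun h δq h₀ hN => ?_⟩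
  · rw [reducedVariation_eq_inducedVariation hπ hρ.contMDiff hAd, ← hA]
    refine h _ ?_ ?_
    · rw [hτ₀, hξ₀, A.lift_zero hπ, infGen_zero, add_zero]
    · rw [hτN, hξN, A.lift_zero hπ, infGen_zero, add_zero]
  -- The splitting alone does not assert uniqueness of `ξ`. Choosing `ξ = 0` whenever `δq k = 0`
  -- secures the end conditions without proving that `ξ ↦ ξ_Q(q)` is injective.
  · have hξ : ∀ k, ∃ ξ : GroupLieAlgebra 𝓘(ℝ, EG) G, (δq k = 0 → ξ = 0) ∧
        A.lift (q k) (mfderiv 𝓘(ℝ, E) 𝓘(ℝ, EB) (orbitProj G : Q → OrbitSpace G Q) (q k) (δq k))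
          + infGen ξ (q k) = δq k := by
      intro k
      by_cases hk : δq k = 0
      · exact ⟨0, fun _ => rfl, by rw [hk, map_zero, A.lift_zero hπ, infGen_zero, add_zero]⟩
      · obtain ⟨ξ, hξ⟩ := A.exists_eq_lift_add_infGen hπ (δq k)
        exact ⟨ξ, fun h => absurd h hk, hξ⟩
    choose ξ hξz hξ using hξ
    have hr := h (fun k => mfderiv 𝓘(ℝ, E) 𝓘(ℝ, EB) (orbitProj G : Q → OrbitSpace G Q) (q k) (δq k))
      ξ (by rw [h₀, map_zero]) (by rw [hN, map_zero]) (hξz _ h₀) (hξz _ hN)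
    rw [reducedVariation_eq_inducedVariation hπ hρ.contMDiff hAd, ← hA] at hr
    rwa [funext hξ] at hr
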